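/- **Tableaux.** For a strict partition $\lambda=(\lambda_1>\dots>\lambda_k>0)$, the shifted shape $\lambda$ has $\lambda_i$ boxes in row $i$ (rows numbered downwards), indented by $i-1$ units, so that row $i$ starts on the main diagonal. An increasing shifted tableau is a filling of a shifted shape with positive integers, strictly increasing from left to right along rows and from top to bottom down columns. **Shifted Hecke insertion.** To insert a positive integer $x$ into an increasing shifted tableau $T$, start by inserting $x$ into the first row. The rules for inserting $x$ into a row (resp. column), possibly empty, are as follows. 1. If $x$ is weakly larger than all entries of the row (resp. column) and adjoining $x$ to its end gives an increasing shifted tableau, do so; the insertion terminates at the new box. 2. If $x$ is weakly larger than all entries of the row (resp. column) but adjoining $x$ to its end does not give an increasing shifted tableau, the tableau is not changed and the insertion terminates: for a nonempty row, at the bottom box of the column containing the rightmost box of this row; for an empty row, at the rightmost box of the previous row; for a column, at the rightmost box of the row containing the bottom box of this column. 3. Otherwise let $y$ be the smallest entry of the row (resp. column) that is strictly larger than $x$. Replace $y$ by $x$ if this gives an increasing shifted tableau; otherwise change nothing. In both cases continue by inserting $y$: if $x$ was inserted into a row and $y$ was not on the main diagonal, into the row below; if $x$ was inserted into a column, or if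 $y$ was on the main diagonal, into the next column to the right of the one containing $y$ (and from then on only into columns). **Recording tableau.** For a word $w=w_1w_2\cdots w_n$ of positive integers, insert $w_1,\dots,w_n$ successively, starting with the empty tableau. The recording tableau $Q(w)$ is the filling of the resulting shape with sets of primed and unprimed integers obtained by putting, for each $k=1,\dots,n$, a label into the box where the insertion of $w_k$ terminates: the label $k'$ if that insertion ended with a column insertion or with a failed insertion into an empty row, and the label $k$ otherwise. **Descent sets.** The descent set of $w$ is $\mathcal D(w)=\{i : 1\le i<n,\ w_i>w_{i+1}\}$. The descent set $\mathcal D(Q)$ of a recording tableau $Q$ is the set of all $i$ such that at least one of the following holds: - both $i$ and $(i+1)'$ appear in $Q$; - $i$ and $i+1$ appear in $Q$, and $i$ is in a row strictly above that of $i+1$; - $i'$ and $(i+1)'$ appear in $Q$, and $i'$ is in a row weakly below that of $(i+1)'$ but not in the same box. **Theorem.** For every word $w$ of positive integers, $\mathcal D(w)=\mathcal D(Q(w))$. -/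

import Mathlib

namespace ShiftedHecke

/-- A finite set of boxes `(r, c)` (row `r`, column `c`, both numbered from `0`, rows downwards),
each box filled with a number. Values of `entry` outside `cells` are irrelevant. -/
structure Filling where
  cells : Finset (ℕ × ℕ)
  entry : ℕ × ℕ → ℕ

/-- `S` is the shifted shape of a strict partition `λ₀ > λ₁ > ⋯`: row `r` occupies the columns
`r, …, r + λ_r - 1`. It is expressed by closure to the left (up to the main diagonal) and upwards;
see `isShiftedShape_iff` for the version with the partition. -/
def IsShiftedShape (S : Finset (ℕ × ℕ)) : Prop :=
  ∀ b ∈ S, b.1 ≤ b.2 ∧ (b.1 < b.2 → (b.1, b.2 - 1) ∈ S) ∧ (0 < b.1 → (b.1 - 1, b.2) ∈ S)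

instance (S : Finset (ℕ × ℕ)) : Decidable (IsShiftedShape S) := by
  unfold IsShiftedShape; infer_instance

/-- Shifted shapes are the diagrams of strict partitions (padded with zeros). -/
theorem isShiftedShape_iff (S : Finset (ℕ × ℕ)) :
    IsShiftedShape S ↔ ∃ lam : ℕ → ℕ, (∀ i, 0 < lam (i + 1) → lam (i + 1) < lam i) ∧
      ∀ r c, (r, c) ∈ S ↔ r ≤ c ∧ c < r + lam r := by
  constructor
  · intro h
    have hleft : ∀ r c d, (r, c + d) ∈ S → r ≤ c → (r, c) ∈ S := by
      intro r c d
      induction d with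
      | zero => intro h1 _; simpa using h1
      | succ d ih =>
        intro h1 h2
        exact ih ((h _ h1).2.1 (by simp; omega)) h2
    have hex : ∀ r, ∃ l, (r, r + l) ∉ S := by
      intro r
      by_contra hcon
      push Not at hcon
      have hinj : Function.Injective (fun l : ℕ => (r, r + l)) := by
        intro a b hab
        simpa using hab
      exact Set.infinite_of_injective_forall_mem (s := (S : Set (ℕ × ℕ))) hinj
        (fun l => by simpa using hcon l) S.finite_toSet
    classical
    have hrow : ∀ r c, (r, c) ∈ S ↔ r ≤ c ∧ c < r + Nat.find (hex r) := by
      intro r c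
      constructor
      · intro hc
        have hrc := (h _ hc).1
        refine ⟨hrc, ?_⟩
        by_contra hlt
        push Not at hlt
        apply Nat.find_spec (hex r)
        apply hleft r _ (c - (r + Nat.find (hex r))) _ (by omega)
        rwa [Nat.add_sub_cancel' hlt]
      · rintro ⟨h1, h2⟩
        have := Nat.find_min (hex r) (m := c - r) (by omega)
        rw [Nat.add_sub_cancel' h1] at this
        exact not_not.mp this
    refine ⟨fun r => Nat.find (hex r), ?_, hrow⟩
    intro i hi
    change 0 < Nat.find (hex (i + 1)) at hi
    change Nat.find (hex (i + 1)) < Nat.find (hex i)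
    have h1 : (i + 1, i + Nat.find (hex (i + 1))) ∈ S := (hrow _ _).2 ⟨by omega, by omega⟩
    have h2 := (h _ h1).2.2 (by simp)
    have := (hrow _ _).1 h2
    simp only [Nat.add_sub_cancel] at this
    omega
  · rintro ⟨lam, hlam, hS⟩ ⟨r, c⟩ hb
    have hb' := (hS r c).1 hb
    refine ⟨hb'.1, fun h => (hS _ _).2 ⟨by simp at h ⊢; omega, by simp at h ⊢; omega⟩, fun h => ?_⟩
    obtain ⟨k, rfl⟩ : ∃ k, r = k + 1 := ⟨r - 1, by simp at h; omega⟩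
    have := hlam k (by omega)
    exact (hS _ _).2 ⟨by simp; omega, by simp; omega⟩

namespace Filling

/-- An increasing shifted tableau: a filling of a shifted shape, strictly increasing along rows
from left to right and along columns from top to bottom. -/
def IsIncreasing (T : Filling) : Prop :=
  IsShiftedShape T.cells ∧
  (∀ a ∈ T.cells, ∀ b ∈ T.cells, a.1 = b.1 → a.2 < b.2 → T.entry a < T.entry b) ∧
  (∀ a ∈ T.cells, ∀ b ∈ T.cells, a.2 = b.2 → a.1 < b.1 → T.entry a < T.entry b)

instance (T : Filling) : Decidable T.IsIncreasing := by
  unfold IsIncreasing; infer_instance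

/-- The empty tableau. -/
def empty : Filling := ⟨∅, fun _ => 0⟩

/-- Put the label `x` into the box `b` (adjoining the box if it is not there yet,
replacing its label if it is). -/
def put (T : Filling) (b : ℕ × ℕ) (x : ℕ) : Filling :=
  ⟨insert b T.cells, Function.update T.entry b x⟩

/-- Number of boxes in row `r`. -/
def rowLen (T : Filling) (r : ℕ) : ℕ := (T.cells.filter (fun b => b.1 = r)).card

/-- Number of boxes in column `c`. -/
def colLen (T : Filling) (c : ℕ) : ℕ := (T.cells.filter (fun b => b.2 = c)).card

/-- The box just after the last box of row `r` (rows start on the diagonal). -/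
def rowEnd (T : Filling) (r : ℕ) : ℕ × ℕ := (r, r + T.rowLen r)

/-- The box just below the last box of column `c` (columns start in the top row). -/
def colEnd (T : Filling) (c : ℕ) : ℕ × ℕ := (T.colLen c, c)

/-- The rightmost box of a nonempty row `r`. -/
def rowLast (T : Filling) (r : ℕ) : ℕ × ℕ := (r, r + T.rowLen r - 1)

/-- The bottom box of a nonempty column `c`. -/
def colLast (T : Filling) (c : ℕ) : ℕ × ℕ := (T.colLen c - 1, c)

/-- Columns of the boxes of row `r` whose label is strictly larger than `x`. -/
def rowLarger (T : Filling) (r x : ℕ) : Finset ℕ :=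
  (T.cells.filter (fun b => b.1 = r ∧ x < T.entry b)).image Prod.snd

/-- Rows of the boxes of column `c` whose label is strictly larger than `x`. -/
def colLarger (T : Filling) (c x : ℕ) : Finset ℕ :=
  (T.cells.filter (fun b => b.2 = c ∧ x < T.entry b)).image Prod.fst

/-- Replace the label of the box `b` by `x` if this gives an increasing tableau;
otherwise change nothing. -/
def tryPut (T : Filling) (b : ℕ × ℕ) (x : ℕ) : Filling :=
  if (T.put b x).IsIncreasing then T.put b x else T

theorem tryPut_cells (T : Filling) (b : ℕ × ℕ) (x : ℕ) (hb : b ∈ T.cells) :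
    (T.tryPut b x).cells = T.cells := by
  unfold tryPut put
  split
  · simpa using hb
  · rfl

theorem mem_of_mem_rowLarger {T : Filling} {r x c : ℕ} (h : c ∈ T.rowLarger r x) :
    (r, c) ∈ T.cells := by
  simp only [rowLarger, Finset.mem_image, Finset.mem_filter] at h
  obtain ⟨⟨r', c'⟩, ⟨h1, h2, -⟩, h3⟩ := h
  simp only at h2 h3
  subst h2 h3
  exact h1

theorem mem_of_mem_colLarger {T : Filling} {c x r : ℕ} (h : r ∈ T.colLarger c x) :
    (r, c) ∈ T.cells := by
  simp only [colLarger, Finset.mem_image, Finset.mem_filter] at h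
  obtain ⟨⟨r', c'⟩, ⟨h1, h2, -⟩, h3⟩ := h
  simp only at h2 h3
  subst h2 h3
  exact h1

end Filling

/-- Result of an insertion: the new tableau, the box where the insertion terminates, and whether
this is to be recorded by a primed label. -/
structure InsertResult where
  tableau : Filling
  box : ℕ × ℕ
  primed : Bool

/-- Column insertion of `x`, starting with column `c`. The smallest label larger than `x` in a
(strictly increasing) column is the topmost one. -/
def colInsert (T : Filling) (c x : ℕ) : InsertResult :=
  if h : (T.colLarger c x).Nonempty then
    colInsert (T.tryPut ((T.colLarger c x).min' h, c) x) (c + 1)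
      (T.entry ((T.colLarger c x).min' h, c))
  else if (T.put (T.colEnd c) x).IsIncreasing then
    ⟨T.put (T.colEnd c) x, T.colEnd c, true⟩
  else
    ⟨T, T.rowLast (T.colLast c).1, true⟩
termination_by (T.cells.filter (fun b => c ≤ b.2)).card
decreasing_by
  have hm := Filling.mem_of_mem_colLarger (Finset.min'_mem _ h)
  rw [Filling.tryPut_cells _ _ _ hm]
  apply Finset.card_lt_card
  refine ⟨fun b hb => ?_, fun hsub => ?_⟩
  · simp only [Finset.mem_filter] at hb ⊢
    exact ⟨hb.1, by omega⟩
  · have := hsub (Finset.mem_filter.2 ⟨hm, le_refl _⟩)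
    simp at this

/-- Row insertion of `x`, starting with row `r`. The smallest label larger than `x` in a
(strictly increasing) row is the leftmost one; if it lies on the main diagonal, i.e. in column `r`,
the insertion goes on by column insertion into the column `r + 1`, otherwise by row insertion into
the row `r + 1`. -/
def rowInsert (T : Filling) (r x : ℕ) : InsertResult :=
  if h : (T.rowLarger r x).Nonempty then
    if (T.rowLarger r x).min' h = r then
      colInsert (T.tryPut (r, (T.rowLarger r x).min' h) x) (r + 1)
        (T.entry (r, (T.rowLarger r x).min' h))
    else
      rowInsert (T.tryPut (r, (T.rowLarger r x).min' h) x) (r + 1)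
        (T.entry (r, (T.rowLarger r x).min' h))
  else if (T.put (T.rowEnd r) x).IsIncreasing then
    ⟨T.put (T.rowEnd r) x, T.rowEnd r, false⟩
  else if T.rowLen r = 0 then
    ⟨T, T.rowLast (r - 1), true⟩
  else
    ⟨T, T.colLast (T.rowLast r).2, false⟩
termination_by (T.cells.filter (fun b => r ≤ b.1)).card
decreasing_by
  have hm := Filling.mem_of_mem_rowLarger (Finset.min'_mem _ h)
  rw [Filling.tryPut_cells _ _ _ hm]
  apply Finset.card_lt_card
  refine ⟨fun b hb => ?_, fun hsub => ?_⟩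
  · simp only [Finset.mem_filter] at hb ⊢
    exact ⟨hb.1, by omega⟩
  · have := hsub (Finset.mem_filter.2 ⟨hm, le_refl _⟩)
    simp at this

/-- Shifted Hecke insertion of a letter: row insertion into the first row. -/
def insertLetter (T : Filling) (x : ℕ) : InsertResult := rowInsert T 0 x

/-- A primed or unprimed integer. -/
structure Label where
  value : ℕ
  primed : Bool
deriving DecidableEq

/-- Set-valued fillings: the set of labels in each box (empty outside the shape). -/
abbrev SetFilling := ℕ × ℕ → Finset Label

/-- The insertion tableau of the letters read so far, the recording tableau, and the number of
letters read. -/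
structure State where
  P : Filling
  Q : SetFilling
  len : ℕ

/-- Read one more letter: insert it and put its (primed or unprimed) position into the box of the
recording tableau where its insertion terminates. -/
def State.step (s : State) (x : ℕ) : State :=
  let res := insertLetter s.P x
  { P := res.tableau
    Q := Function.update s.Q res.box (insert ⟨s.len + 1, res.primed⟩ (s.Q res.box))
    len := s.len + 1 }

/-- Insertion of all the letters of a word, from left to right. -/
def run (w : List ℕ) : State := w.foldl State.step ⟨Filling.empty, fun _ => ∅, 0⟩

/-- The insertion tableau of a word. -/
def insertionTableau (w : List ℕ) : Filling := (run w).P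

/-- The recording tableau of a word. -/
def recordingTableau (w : List ℕ) : SetFilling := (run w).Q

/-- The descent set of a word `w₁ w₂ ⋯ wₙ` (positions numbered from `1`). -/
def wordDescents (w : List ℕ) : Set ℕ :=
  {i | 1 ≤ i ∧ ∃ a b, w[i - 1]? = some a ∧ w[i]? = some b ∧ b < a}

/-- The descent set of a standard set-valued shifted tableau. -/
def tableauDescents (Q : SetFilling) : Set ℕ :=
  {i |
    (∃ s t, ⟨i, false⟩ ∈ Q s ∧ ⟨i + 1, true⟩ ∈ Q t) ∨
    (∃ s t, ⟨i, false⟩ ∈ Q s ∧ ⟨i + 1, false⟩ ∈ Q t ∧ s.1 < t.1) ∨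
    (∃ s t, ⟨i, true⟩ ∈ Q s ∧ ⟨i + 1, true⟩ ∈ Q t ∧ t.1 ≤ s.1 ∧ s ≠ t)}

end ShiftedHecke

/-! Reflect the shifted tableau in the main diagonal to get a symmetric "doubled" tableau. Column
`k` of the shifted tableau, followed by its continuation, becomes row `k` of the doubled one, so
shifted Hecke insertion becomes plain row insertion into rows 0, 1, 2, … (round `k` acts on row
`k`), and the switch to columns is just the bumping path crossing the diagonal. The insertion stops
in some round `e` at a box `(a, b)` of the doubled shape, and its label is primed exactly when `b <
a`. In the final shape row `e` ends at column `b`, column `b` ends at row `a`, and `e ≤ a`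
(`Terminates`).

For consecutive letters `x`, `x'` with boxes `(a, b)`, `(a', b')` there is a dichotomy. If `x ≤ x'`,
the second insertion carries a weakly larger letter in each round and takes no more rounds, whence
`a' ≤ a` and either `b < b'` or the boxes agree (`Terminates.nondescent`). If `x' < x`, the second
insertion keeps bumping through row `a`, whence `a < a'` and `b' ≤ b` (`Terminates.descent`).
Folding back along the diagonal turns these inequalities into the three clauses defining descents of
the recording tableau.

The delicate point is a blocked replacement. By `Blocked.reason`, either the left neighbour already
equals the letter, or the previous round was blocked in the same column; in both cases there remains
a box (`IsBound`) against which the next insertion can be compared. -/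

namespace ShiftedHecke

/-! ### Doubled shapes and doubled tableaux -/

/-- The box of the shifted shape that represents the box `(i, j)` of the doubled, symmetric
shape. -/
def cell (i j : ℕ) : ℕ × ℕ := (min i j, max i j)

theorem cell_comm (i j : ℕ) : cell i j = cell j i := by
  simp [cell, min_comm, max_comm]

theorem cell_of_le {i j : ℕ} (h : i ≤ j) : cell i j = (i, j) := by
  simp [cell, h]

theorem cell_of_ge {i j : ℕ} (h : j ≤ i) : cell i j = (j, i) := by
  simp [cell, h]

theorem cell_right_injective {i j j' : ℕ} (h : cell i j = cell i j') : j = j' := by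
  simp only [cell, Prod.mk.injEq] at h
  omega

theorem cell_succ_ne (i j : ℕ) : cell (i + 1) j ≠ cell i j := by
  intro h
  simp only [cell, Prod.mk.injEq] at h
  omega

theorem IsShiftedShape.mem_of_le {S : Finset (ℕ × ℕ)} (hS : IsShiftedShape S) {r c r' c' : ℕ}
    (h : (r, c) ∈ S) (hr : r' ≤ r) (hc : c' ≤ c) (hrc : r' ≤ c') : (r', c') ∈ S := by
  have up : ∀ d r, (r + d, c) ∈ S → (r, c) ∈ S := by
    intro d
    induction d with
    | zero => exact fun r h => h
    | succ d ih => exact fun r h => ih r ((hS _ h).2.2 (by simp))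
  have left : ∀ d c, (r', c + d) ∈ S → r' ≤ c → (r', c) ∈ S := by
    intro d
    induction d with
    | zero => exact fun c h _ => h
    | succ d ih =>
      exact fun c h hc => ih c ((hS _ h).2.1 (by simp; omega)) hc
  refine left (c - c') c' ?_ hrc
  rw [Nat.add_sub_cancel' hc]
  apply up (r - r')
  rwa [Nat.add_sub_cancel' hr]

namespace Filling

/-- The box `(i, j)` belongs to the doubled shape of `T`. -/
def Has (T : Filling) (i j : ℕ) : Prop := cell i j ∈ T.cells

/-- The label of the box `(i, j)` of the doubled tableau of `T`. -/
def val (T : Filling) (i j : ℕ) : ℕ := T.entry (cell i j)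

theorem has_comm {T : Filling} {i j : ℕ} : T.Has i j ↔ T.Has j i := by
  rw [Has, cell_comm, Has]

theorem val_comm (T : Filling) (i j : ℕ) : T.val i j = T.val j i := by
  rw [val, cell_comm, val]

theorem IsIncreasing.has_mono {T : Filling} (hT : T.IsIncreasing) {i j i' j' : ℕ}
    (h : T.Has i j) (hi : i' ≤ i) (hj : j' ≤ j) : T.Has i' j' :=
  hT.1.mem_of_le h (by omega) (by omega) (by omega)

theorem IsIncreasing.val_lt_right {T : Filling} (hT : T.IsIncreasing) {i j j' : ℕ}
    (h : T.Has i j) (hj : j' < j) : T.val i j' < T.val i j := by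
  have h' : T.Has i j' := hT.has_mono h le_rfl hj.le
  rcases le_or_gt i j' with h1 | h1
  · rw [Has, cell_of_le (by omega)] at h h'
    rw [val, val, cell_of_le (by omega), cell_of_le (by omega)]
    exact hT.2.1 _ h' _ h rfl hj
  rcases le_or_gt j i with h2 | h2
  · rw [Has, cell_of_ge (by omega)] at h h'
    rw [val, val, cell_of_ge (by omega), cell_of_ge (by omega)]
    exact hT.2.2 _ h' _ h rfl hj
  -- Here `j' < i < j`, so the doubled row turns at the diagonal: compare down column `i` to the
  -- diagonal box, then along row `i`.
  · have h3 : T.Has i i := hT.has_mono h le_rfl h2.le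
    rw [Has, cell_of_le (by omega)] at h h3
    rw [Has, cell_of_ge (by omega)] at h'
    rw [val, val, cell_of_le h2.le, cell_of_ge h1.le]
    exact (hT.2.2 _ h' _ h3 rfl h1).trans (hT.2.1 _ h3 _ h rfl h2)

theorem IsIncreasing.val_le_right {T : Filling} (hT : T.IsIncreasing) {i j j' : ℕ}
    (h : T.Has i j) (hj : j' ≤ j) : T.val i j' ≤ T.val i j := by
  rcases hj.eq_or_lt with rfl | hj
  · exact le_rfl
  · exact (hT.val_lt_right h hj).le

theorem IsIncreasing.val_lt_down {T : Filling} (hT : T.IsIncreasing) {i i' j : ℕ}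
    (h : T.Has i j) (hi : i' < i) : T.val i' j < T.val i j := by
  rw [val_comm T i', val_comm T i]
  exact hT.val_lt_right (has_comm.1 h) hi

theorem IsIncreasing.val_le_down {T : Filling} (hT : T.IsIncreasing) {i i' j : ℕ}
    (h : T.Has i j) (hi : i' ≤ i) : T.val i' j ≤ T.val i j := by
  rw [val_comm T i', val_comm T i]
  exact hT.val_le_right (has_comm.1 h) hi

theorem IsIncreasing.exists_length {T : Filling} (hT : T.IsIncreasing) (i : ℕ) :
    ∃ l, ∀ j, T.Has i j ↔ j < l := by
  classical
  have hex : ∃ l, ¬ T.Has i l := by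
    by_contra hcon
    push Not at hcon
    have hinj : Function.Injective (fun l : ℕ => cell i l) := fun _ _ => cell_right_injective
    exact Set.infinite_of_injective_forall_mem (s := (T.cells : Set (ℕ × ℕ))) hinj
      (fun l => hcon l) T.cells.finite_toSet
  refine ⟨Nat.find hex, fun j => ⟨fun h => ?_, fun h => not_not.1 (Nat.find_min hex h)⟩⟩
  by_contra hlt
  exact Nat.find_spec hex (hT.has_mono h le_rfl (not_lt.1 hlt))

theorem mem_cells_iff {T : Filling} (hT : T.IsIncreasing) {r c : ℕ} :
    (r, c) ∈ T.cells ↔ r ≤ c ∧ T.Has r c := by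
  constructor
  · intro h
    have := (hT.1 _ h).1
    exact ⟨this, by rwa [Has, cell_of_le this]⟩
  · rintro ⟨h1, h2⟩
    rwa [Has, cell_of_le h1] at h2

/-- The first `k` boxes of the doubled row lie left of the diagonal and are reflections of boxes of
column `k`; only the rest belongs to the shifted row. -/
theorem IsIncreasing.rowLen_eq {T : Filling} (hT : T.IsIncreasing) {k l : ℕ}
    (hl : ∀ j, T.Has k j ↔ j < l) : T.rowLen k = l - k := by
  have : T.cells.filter (fun b => b.1 = k) = (Finset.Ico k l).image (fun c => (k, c)) := by
    ext ⟨r, c⟩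
    simp only [Finset.mem_filter, mem_cells_iff hT, Finset.mem_image, Finset.mem_Ico,
      Prod.mk.injEq]
    constructor
    · rintro ⟨⟨h1, h2⟩, rfl⟩
      exact ⟨c, ⟨h1, (hl c).1 h2⟩, rfl, rfl⟩
    · rintro ⟨c, ⟨h1, h2⟩, rfl, rfl⟩
      exact ⟨⟨h1, (hl c).2 h2⟩, rfl⟩
  rw [rowLen, this, Finset.card_image_of_injective _ (fun a b h => by simpa using h), Nat.card_Ico]

theorem IsIncreasing.colLen_eq {T : Filling} (hT : T.IsIncreasing) {k l : ℕ}
    (hl : ∀ j, T.Has k j ↔ j < l) : T.colLen k = min l (k + 1) := by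
  have : T.cells.filter (fun b => b.2 = k)
      = (Finset.range (min l (k + 1))).image (fun r => (r, k)) := by
    ext ⟨r, c⟩
    simp only [Finset.mem_filter, mem_cells_iff hT, Finset.mem_image, Finset.mem_range,
      Prod.mk.injEq, has_comm (i := r)]
    constructor
    · rintro ⟨⟨h1, h2⟩, rfl⟩
      have := (hl r).1 h2
      exact ⟨r, by omega, rfl, rfl⟩
    · rintro ⟨r, h1, rfl, rfl⟩
      exact ⟨⟨by omega, (hl r).2 (by omega)⟩, rfl⟩
  rw [colLen, this, Finset.card_image_of_injective _ (fun a b h => by simpa using h),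
    Finset.card_range]

theorem mem_rowLarger_iff {T : Filling} (hT : T.IsIncreasing) {k x j : ℕ} :
    j ∈ T.rowLarger k x ↔ k ≤ j ∧ T.Has k j ∧ x < T.val k j := by
  simp only [rowLarger, Finset.mem_image, Finset.mem_filter]
  constructor
  · rintro ⟨⟨r, c⟩, ⟨h1, rfl, h3⟩, rfl⟩
    obtain ⟨h4, h5⟩ := (mem_cells_iff hT).1 h1
    exact ⟨h4, h5, by rwa [val, cell_of_le h4]⟩
  · rintro ⟨h1, h2, h3⟩
    rw [val, cell_of_le h1] at h3
    exact ⟨(k, j), ⟨(mem_cells_iff hT).2 ⟨h1, h2⟩, rfl, h3⟩, rfl⟩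

theorem mem_colLarger_iff {T : Filling} (hT : T.IsIncreasing) {k x j : ℕ} :
    j ∈ T.colLarger k x ↔ j ≤ k ∧ T.Has k j ∧ x < T.val k j := by
  simp only [colLarger, Finset.mem_image, Finset.mem_filter]
  constructor
  · rintro ⟨⟨r, c⟩, ⟨h1, rfl, h3⟩, rfl⟩
    obtain ⟨h4, h5⟩ := (mem_cells_iff hT).1 h1
    exact ⟨h4, has_comm.1 h5, by rwa [val, cell_of_ge h4]⟩
  · rintro ⟨h1, h2, h3⟩
    rw [val, cell_of_ge h1] at h3
    exact ⟨(j, k), ⟨(mem_cells_iff hT).2 ⟨h1, has_comm.1 h2⟩, rfl, h3⟩, rfl⟩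

theorem put_isIncreasing_of_le {T : Filling} (hT : T.IsIncreasing) {k p x : ℕ} (hkp : k ≤ p)
    (hl : ∀ j < p, T.Has k j ∧ T.val k j < x) (hr : ∀ j > p, T.Has k j → x < T.val k j)
    (hu : ∀ i < k, T.Has i p ∧ T.val i p < x) (hd : ∀ i > k, T.Has i p → x < T.val i p) :
    (T.put (cell k p) x).IsIncreasing := by
  rw [cell_of_le hkp]
  refine ⟨?_, ?_, ?_⟩
  · rintro ⟨r, c⟩ hb
    simp only [put, Finset.mem_insert] at hb ⊢
    rcases hb with hb | hb
    · obtain ⟨rfl, rfl⟩ := Prod.mk.inj hb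
      refine ⟨hkp, fun h => Or.inr ?_, fun h => Or.inr ?_⟩
      · exact (mem_cells_iff hT).2 ⟨by omega, (hl _ (by omega)).1⟩
      · exact (mem_cells_iff hT).2 ⟨by omega, (hu _ (by omega)).1⟩
    · exact ⟨(hT.1 _ hb).1, fun h => Or.inr ((hT.1 _ hb).2.1 h),
        fun h => Or.inr ((hT.1 _ hb).2.2 h)⟩
  · rintro ⟨r, c⟩ ha ⟨r', c'⟩ hb h1 h2
    simp only [put, Finset.mem_insert] at ha hb ⊢
    simp only at h1 h2
    subst h1
    by_cases hA : (r, c) = (k, p) <;> by_cases hB : (r, c') = (k, p)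
    · simp only [Prod.mk.injEq] at hA hB; omega
    · obtain ⟨rfl, rfl⟩ := Prod.mk.inj hA
      have h3 := (mem_cells_iff hT).1 (hb.resolve_left hB)
      have := hr _ h2 h3.2
      rw [Function.update_self, Function.update_of_ne hB]
      rwa [val, cell_of_le h3.1] at this
    · obtain ⟨rfl, rfl⟩ := Prod.mk.inj hB
      have h3 := (mem_cells_iff hT).1 (ha.resolve_left hA)
      have := (hl _ h2).2
      rw [Function.update_self, Function.update_of_ne hA]
      rwa [val, cell_of_le h3.1] at this
    · rw [Function.update_of_ne hA, Function.update_of_ne hB]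
      exact hT.2.1 _ (ha.resolve_left hA) _ (hb.resolve_left hB) rfl h2
  · rintro ⟨r, c⟩ ha ⟨r', c'⟩ hb h1 h2
    simp only [put, Finset.mem_insert] at ha hb ⊢
    simp only at h1 h2
    subst h1
    by_cases hA : (r, c) = (k, p) <;> by_cases hB : (r', c) = (k, p)
    · simp only [Prod.mk.injEq] at hA hB; omega
    · obtain ⟨rfl, rfl⟩ := Prod.mk.inj hA
      have h3 := (mem_cells_iff hT).1 (hb.resolve_left hB)
      have := hd _ h2 h3.2
      rw [Function.update_self, Function.update_of_ne hB]
      rwa [val, cell_of_le h3.1] at this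
    · obtain ⟨rfl, rfl⟩ := Prod.mk.inj hB
      have h3 := (mem_cells_iff hT).1 (ha.resolve_left hA)
      have := (hu _ h2).2
      rw [Function.update_self, Function.update_of_ne hA]
      rwa [val, cell_of_le h3.1] at this
    · rw [Function.update_of_ne hA, Function.update_of_ne hB]
      exact hT.2.2 _ (ha.resolve_left hA) _ (hb.resolve_left hB) rfl h2

/-- The four conditions are exchanged in pairs by reflection in the diagonal, which reduces
everything to a box on or above it. -/
theorem put_isIncreasing {T : Filling} (hT : T.IsIncreasing) {k p x : ℕ}
    (hl : ∀ j < p, T.Has k j ∧ T.val k j < x) (hr : ∀ j > p, T.Has k j → x < T.val k j)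
    (hu : ∀ i < k, T.Has i p ∧ T.val i p < x) (hd : ∀ i > k, T.Has i p → x < T.val i p) :
    (T.put (cell k p) x).IsIncreasing := by
  rcases le_total k p with h | h
  · exact put_isIncreasing_of_le hT h hl hr hu hd
  · rw [cell_comm]
    refine put_isIncreasing_of_le hT h (fun j hj => ?_) (fun j hj hh => ?_) (fun j hj => ?_)
      (fun j hj hh => ?_)
    · rw [has_comm, val_comm]; exact hu j hj
    · rw [has_comm] at hh; rw [val_comm]; exact hd j hj hh
    · rw [has_comm, val_comm]; exact hl j hj
    · rw [has_comm] at hh; rw [val_comm]; exact hr j hj hh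

theorem put_entry_self (T : Filling) (b : ℕ × ℕ) (x : ℕ) : (T.put b x).entry b = x :=
  Function.update_self _ _ _

theorem put_entry_of_ne (T : Filling) {b c : ℕ × ℕ} (x : ℕ) (h : c ≠ b) :
    (T.put b x).entry c = T.entry c :=
  Function.update_of_ne h _ _

theorem tryPut_isIncreasing {T : Filling} (hT : T.IsIncreasing) (b : ℕ × ℕ) (x : ℕ) :
    (T.tryPut b x).IsIncreasing := by
  unfold tryPut
  split
  · assumption
  · exact hT

theorem empty_isIncreasing : empty.IsIncreasing := by decide

/-! ### Rounds of row insertion into the doubled tableau -/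

/-- Some label of row `k` of the doubled tableau is larger than `x`. -/
def Bumps (T : Filling) (k x : ℕ) : Prop := ∃ j, T.Has k j ∧ x < T.val k j

/-- Position of the smallest label larger than `x` in row `k` of the doubled tableau. -/
noncomputable def bumpPos (T : Filling) (k x : ℕ) : ℕ := sInf {j | T.Has k j ∧ x < T.val k j}

theorem Bumps.has {T : Filling} {k x : ℕ} (h : T.Bumps k x) : T.Has k (T.bumpPos k x) :=
  (Nat.sInf_mem (s := {j | T.Has k j ∧ x < T.val k j}) h).1

theorem Bumps.lt_val {T : Filling} {k x : ℕ} (h : T.Bumps k x) : x < T.val k (T.bumpPos k x) :=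
  (Nat.sInf_mem (s := {j | T.Has k j ∧ x < T.val k j}) h).2

theorem bumpPos_le {T : Filling} {k x j : ℕ} (h : T.Has k j) (hx : x < T.val k j) :
    T.bumpPos k x ≤ j :=
  Nat.sInf_le ⟨h, hx⟩

end Filling

open Filling

/-- The tableau and the letter to be inserted after `k` rounds of row insertion of `x` into the
doubled tableau of `T`. It is meaningful as long as every round bumps a label. -/
noncomputable def bumpState (T : Filling) (x : ℕ) : ℕ → Filling × ℕ
  | 0 => (T, x)
  | k + 1 =>
    let s := bumpState T x k
    let b := cell k (s.1.bumpPos k s.2)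
    (s.1.tryPut b s.2, s.1.entry b)

/-- The tableau after `k` rounds. -/
noncomputable def tab (T : Filling) (x k : ℕ) : Filling := (bumpState T x k).1

/-- The letter to be inserted in round `k`. -/
noncomputable def letter (T : Filling) (x k : ℕ) : ℕ := (bumpState T x k).2

/-- The position of the label bumped in round `k`. -/
noncomputable def pos (T : Filling) (x k : ℕ) : ℕ := (tab T x k).bumpPos k (letter T x k)

/-- The first `k` rounds all bump a label. -/
def Continues (T : Filling) (x k : ℕ) : Prop := ∀ i < k, (tab T x i).Bumps i (letter T x i)

/-- The letter of round `k` cannot be put into position `p` of row `k`. -/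
def Blocked (T : Filling) (x k p : ℕ) : Prop :=
  ¬ ((tab T x k).put (cell k p) (letter T x k)).IsIncreasing

theorem tab_succ (T : Filling) (x k : ℕ) :
    tab T x (k + 1) = (tab T x k).tryPut (cell k (pos T x k)) (letter T x k) := rfl

theorem tab_succ_of_blocked {T : Filling} {x k : ℕ} (h : Blocked T x k (pos T x k)) :
    tab T x (k + 1) = tab T x k := by
  rw [tab_succ, tryPut, if_neg h]

theorem tab_succ_of_not_blocked {T : Filling} {x k : ℕ} (h : ¬ Blocked T x k (pos T x k)) :
    tab T x (k + 1) = (tab T x k).put (cell k (pos T x k)) (letter T x k) := by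
  rw [tab_succ, tryPut, if_pos (not_not.1 h)]

theorem tab_succ_entry (T : Filling) (x k : ℕ) (c : ℕ × ℕ) :
    (tab T x (k + 1)).entry c = (tab T x k).entry c ∨
      c = cell k (pos T x k) ∧ (tab T x (k + 1)).entry c = letter T x k ∧
        (tab T x k).entry c = letter T x (k + 1) := by
  by_cases h : Blocked T x k (pos T x k)
  · rw [tab_succ_of_blocked h]; exact Or.inl rfl
  · rw [tab_succ_of_not_blocked h]
    by_cases hc : c = cell k (pos T x k)
    · refine Or.inr ⟨hc, ?_, ?_⟩
      · rw [hc, put_entry_self]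
      · rw [hc]; rfl
    · left
      rw [put_entry_of_ne _ _ hc]

theorem tab_isIncreasing {T : Filling} (hT : T.IsIncreasing) (x k : ℕ) :
    (tab T x k).IsIncreasing := by
  induction k with
  | zero => exact hT
  | succ k ih => exact tryPut_isIncreasing ih _ _

theorem Continues.mono {T : Filling} {x k m : ℕ} (h : Continues T x k) (hm : m ≤ k) :
    Continues T x m := fun i hi => h i (by omega)

theorem Continues.succ {T : Filling} {x k : ℕ} (h : Continues T x k)
    (hk : (tab T x k).Bumps k (letter T x k)) : Continues T x (k + 1) := by
  intro i hi
  rcases (Nat.lt_succ_iff.1 hi).eq_or_lt with rfl | hi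
  · exact hk
  · exact h i hi

theorem Continues.cells {T : Filling} {x k : ℕ} (h : Continues T x k) :
    (tab T x k).cells = T.cells := by
  induction k with
  | zero => rfl
  | succ k ih =>
    rw [tab_succ, tryPut_cells, ih (h.mono (by omega))]
    exact (h k (by omega)).has

theorem Continues.has {T : Filling} {x k : ℕ} (h : Continues T x k) {i j : ℕ} :
    (tab T x k).Has i j ↔ T.Has i j := by
  rw [Has, h.cells, Has]

theorem Continues.letter_lt {T : Filling} {x k : ℕ} (h : Continues T x (k + 1)) :
    letter T x k < letter T x (k + 1) := (h k (by omega)).lt_val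

theorem Continues.letter_mono {T : Filling} {x k m : ℕ} (h : Continues T x k) (hm : m ≤ k) :
    letter T x m ≤ letter T x k := by
  induction k with
  | zero => rw [Nat.le_zero.1 hm]
  | succ k ih =>
    rcases hm.eq_or_lt with rfl | hm
    · exact le_rfl
    · exact (ih (h.mono (by omega)) (by omega)).trans h.letter_lt.le

theorem Continues.has_pos {T : Filling} {x k : ℕ} (h : Continues T x (k + 1)) :
    T.Has k (pos T x k) :=
  (h.mono (Nat.le_succ k)).has.1 (h k (by omega)).has

theorem val_le_of_lt_pos {T : Filling} (hT : T.IsIncreasing) {x k j : ℕ}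
    (h : Continues T x (k + 1)) (hj : j < pos T x k) : (tab T x k).val k j ≤ letter T x k := by
  by_contra hcon
  have h1 := (tab_isIncreasing hT x k).has_mono (h k (by omega)).has le_rfl hj.le
  exact absurd (bumpPos_le h1 (not_le.1 hcon)) (not_le.2 hj)

/-- Entries not larger than the current letter stay unchanged in all later rounds, and labels put
in later rounds are not smaller than the current letter. -/
theorem Continues.entry_later {T : Filling} {x k m : ℕ} (h : Continues T x m) (hk : k ≤ m)
    (c : ℕ × ℕ) : (tab T x m).entry c = (tab T x k).entry c ∨
      letter T x k ≤ (tab T x m).entry c ∧ letter T x k < (tab T x k).entry c := by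
  induction m with
  | zero => rw [Nat.le_zero.1 hk]; exact Or.inl rfl
  | succ m ih =>
    rcases hk.eq_or_lt with rfl | hk
    · exact Or.inl rfl
    have hm := h.mono (Nat.le_succ m)
    have h1 := hm.letter_mono (Nat.lt_succ_iff.1 hk)
    have h2 := h.letter_lt
    have h3 := ih hm (by omega)
    rcases tab_succ_entry T x m c with h4 | ⟨-, h4, h5⟩
    · rw [h4]; exact h3
    · right
      omega

/-- Entries larger than the current letter have not been changed in earlier rounds. -/
theorem Continues.entry_earlier {T : Filling} {x k : ℕ} (h : Continues T x k)
    (c : ℕ × ℕ) : (tab T x k).entry c = T.entry c ∨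
      (tab T x k).entry c < letter T x k ∧ T.entry c ≤ letter T x k := by
  induction k with
  | zero => exact Or.inl rfl
  | succ k ih =>
    have h1 := h.letter_lt
    have h3 := ih (h.mono (Nat.le_succ k))
    rcases tab_succ_entry T x k c with h4 | ⟨-, h4, h5⟩
    · omega
    · omega

/-- If every round bumped, every row would be nonempty, making column 0 infinite. -/
theorem exists_stop {T : Filling} (hT : T.IsIncreasing) (x : ℕ) :
    ∃ e, Continues T x e ∧ ¬ (tab T x e).Bumps e (letter T x e) := by
  classical
  have hex : ∃ e, ¬ (tab T x e).Bumps e (letter T x e) := by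
    by_contra hcon
    push Not at hcon
    have hc : ∀ k, T.Has 0 k := fun k => has_comm.1 <|
      hT.has_mono (Continues.has_pos (k := k) (x := x) (fun i _ => hcon i)) le_rfl (Nat.zero_le _)
    obtain ⟨l, hl⟩ := hT.exists_length 0
    exact absurd ((hl l).1 (hc l)) (lt_irrefl l)
  exact ⟨Nat.find hex, fun i hi => not_not.1 (Nat.find_min hex hi), Nat.find_spec hex⟩

/-- The label just below a bumped label exceeds it. Hence the bumping path moves weakly to the left.
-/
theorem lt_val_below {T : Filling} (hT : T.IsIncreasing) {x k : ℕ} (h : Continues T x (k + 1))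
    (hq : T.Has (k + 1) (pos T x k)) :
    letter T x (k + 1) < (tab T x (k + 1)).val (k + 1) (pos T x k) := by
  have h1 : (tab T x k).val k (pos T x k) < (tab T x k).val (k + 1) (pos T x k) :=
    (tab_isIncreasing hT x k).val_lt_down ((h.mono (Nat.le_succ k)).has.2 hq) (by omega)
  rcases tab_succ_entry T x k (cell (k + 1) (pos T x k)) with h2 | ⟨h2, -⟩
  · rw [val, h2]; exact h1
  · exact absurd h2 (cell_succ_ne _ _)

theorem val_above_lt {T : Filling} (hT : T.IsIncreasing) {x k j : ℕ} (h : Continues T x (k + 1))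
    (hj : j < pos T x k) : (tab T x (k + 1)).val k j < letter T x (k + 1) := by
  have h1 := val_le_of_lt_pos hT h hj
  have h2 := h.letter_lt
  rcases tab_succ_entry T x k (cell k j) with h3 | ⟨h3, -⟩
  · rw [val, h3]; exact h1.trans_lt h2
  · exact absurd (cell_right_injective h3) hj.ne

theorem val_above_le {T : Filling} (hT : T.IsIncreasing) {x k j : ℕ} (h : Continues T x (k + 1))
    (hj : j ≤ pos T x k) : (tab T x (k + 1)).val k j ≤ letter T x (k + 1) := by
  rcases hj.eq_or_lt with rfl | hj
  · have h2 := h.letter_lt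
    rcases tab_succ_entry T x k (cell k (pos T x k)) with h3 | ⟨-, h3, -⟩
    · rw [val, h3]; exact le_rfl
    · rw [val, h3]; exact h2.le
  · exact (val_above_lt hT h hj).le

theorem val_pos_of_not_blocked {T : Filling} {x k : ℕ} (h : ¬ Blocked T x k (pos T x k)) :
    (tab T x (k + 1)).val k (pos T x k) = letter T x k := by
  rw [tab_succ_of_not_blocked h, val, put_entry_self]

/-! ### Blocked replacements and adjunctions -/

/-- The reasons for a replacement or an adjunction to fail. -/
theorem Blocked.reason {T : Filling} (hT : T.IsIncreasing) {x k p : ℕ} (hb : Blocked T x k p)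
    (h : Continues T x k) (hl : ∀ j < p, T.Has k j ∧ (tab T x k).val k j ≤ letter T x k)
    (hp : T.Has k p → letter T x k < (tab T x k).val k p) :
    1 ≤ p ∧ ((tab T x k).val k (p - 1) = letter T x k ∨
      ∃ m, k = m + 1 ∧ pos T x m = p ∧ Blocked T x m p) := by
  induction k generalizing p with
  | zero =>
    have hI := tab_isIncreasing hT x 0
    by_cases hA : ∃ j < p, letter T x 0 ≤ (tab T x 0).val 0 j
    · obtain ⟨j, hj, hA⟩ := hA
      refine ⟨by omega, Or.inl (le_antisymm (hl _ (by omega)).2 (hA.trans ?_))⟩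
      exact hI.val_le_right (h.has.2 (hl (p - 1) (by omega)).1) (by omega)
    · push Not at hA
      refine absurd (put_isIncreasing hI (fun j hj => ⟨h.has.2 (hl j hj).1, hA j hj⟩)
        (fun j hj hh => ?_) (fun i hi => absurd hi (Nat.not_lt_zero i)) (fun i hi hh => ?_)) hb
      · exact (hp (h.has.1 (hI.has_mono hh le_rfl hj.le))).trans (hI.val_lt_right hh hj)
      · exact (hp (h.has.1 (hI.has_mono hh hi.le le_rfl))).trans (hI.val_lt_down hh hi)
  | succ k ih =>
    have hI := tab_isIncreasing hT x (k + 1)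
    have hk := h.mono (Nat.le_succ k)
    by_cases hA : ∃ j < p, letter T x (k + 1) ≤ (tab T x (k + 1)).val (k + 1) j
    · obtain ⟨j, hj, hA⟩ := hA
      refine ⟨by omega, Or.inl (le_antisymm (hl _ (by omega)).2 (hA.trans ?_))⟩
      exact hI.val_le_right (h.has.2 (hl (p - 1) (by omega)).1) (by omega)
    · push Not at hA
      -- Otherwise the column of the previous bump lies left of `p`, and its label in row `k + 1` is
      -- too large for `hl`.
      have hpq : p ≤ pos T x k := by
        by_contra hcon
        have h1 := hl (pos T x k) (by omega)
        exact absurd (lt_val_below hT h h1.1) (not_lt.2 h1.2)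
      have hhas : T.Has k p := hT.has_mono h.has_pos le_rfl hpq
      -- With the left neighbour smaller, only the label directly above can obstruct. It fails to be
      -- smaller than the letter only if the letter was bumped from there and left in place.
      by_cases hB : (tab T x (k + 1)).val k p < letter T x (k + 1)
      · refine absurd (put_isIncreasing hI (fun j hj => ⟨h.has.2 (hl j hj).1, hA j hj⟩)
          (fun j hj hh => ?_) (fun i hi => ⟨?_, ?_⟩) (fun i hi hh => ?_)) hb
        · exact (hp (h.has.1 (hI.has_mono hh le_rfl hj.le))).trans (hI.val_lt_right hh hj)
        · exact h.has.2 (hT.has_mono hhas (by omega) le_rfl)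
        · exact (hI.val_le_down (h.has.2 hhas) (by omega)).trans_lt hB
        · exact (hp (h.has.1 (hI.has_mono hh hi.le le_rfl))).trans (hI.val_lt_down hh hi)
      · have hpq' : pos T x k = p := by
          by_contra hcon
          exact hB (val_above_lt hT h (by omega))
        have hbk : Blocked T x k p := by
          by_contra hcon
          rw [← hpq'] at hcon hB
          exact hB (by rw [val_pos_of_not_blocked hcon]; exact h.letter_lt)
        -- The induction serves only for `1 ≤ p`: a chain of blocked rounds in one column must begin
        -- with an equal left neighbour.
        refine ⟨(ih hbk hk (fun j hj => ⟨hT.has_mono hhas le_rfl hj.le, ?_⟩) (fun _ => ?_)).1,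
          Or.inr ⟨k, rfl, hpq', hbk⟩⟩
        · exact val_le_of_lt_pos hT h (by omega)
        · rw [← hpq']; exact h.letter_lt

/-! ### Termination, and agreement with shifted Hecke insertion -/

/-- The insertion of `x` into `T` has the result `res`: it stops in round `e`, and it terminates at
the box `(a, b)` of the doubled shape. -/
structure Terminates (T : Filling) (x : ℕ) (res : InsertResult) (e a b : ℕ) : Prop where
  cont : Continues T x e
  not_bumps : ¬ (tab T x e).Bumps e (letter T x e)
  box_eq : res.box = cell a b
  primed_eq : res.primed = decide (b < a)
  inc : res.tableau.IsIncreasing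
  has : res.tableau.Has a b
  not_has_right : ¬ res.tableau.Has e (b + 1)
  not_has_below : ¬ res.tableau.Has (a + 1) b
  le : e ≤ a
  result : (a = e ∧ ¬ T.Has e b ∧ res.tableau = (tab T x e).put (cell e b) (letter T x e)) ∨
    (res.tableau = tab T x e ∧ ((tab T x e).val e b = letter T x e ∨
      ∃ m, e = m + 1 ∧ pos T x m = b + 1 ∧ Blocked T x m (b + 1)))

theorem Filling.has_put {T : Filling} {b : ℕ × ℕ} {x i j : ℕ} :
    (T.put b x).Has i j ↔ cell i j = b ∨ T.Has i j := by
  simp [Has, put]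

theorem val_le_of_stop {T : Filling} {x e : ℕ}
    (hs : ¬ (tab T x e).Bumps e (letter T x e)) {j : ℕ} (hj : (tab T x e).Has e j) :
    (tab T x e).val e j ≤ letter T x e := by
  by_contra hcon
  exact hs ⟨j, hj, not_le.1 hcon⟩

theorem Terminates.of_adjoin {T : Filling} (hT : T.IsIncreasing) {x e l : ℕ}
    (hc : Continues T x e) (hs : ¬ (tab T x e).Bumps e (letter T x e))
    (hl : ∀ j, (tab T x e).Has e j ↔ j < l) (hb : ¬ Blocked T x e l) :
    Terminates T x ⟨(tab T x e).put (cell e l) (letter T x e), cell e l, decide (l < e)⟩ e e l where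
  cont := hc
  not_bumps := hs
  box_eq := rfl
  primed_eq := rfl
  inc := not_not.1 hb
  has := has_put.2 (Or.inl rfl)
  not_has_right := by
    rw [has_put, hl]
    rintro (h | h)
    · have := cell_right_injective h
      omega
    · omega
  not_has_below := by
    rw [has_put]
    rintro (h | h)
    · exact cell_succ_ne _ _ h
    · have h1 := (tab_isIncreasing hT x e).has_mono (i' := e) h (by omega) le_rfl
      exact absurd ((hl l).1 h1) (lt_irrefl l)
  le := le_rfl
  result := Or.inl ⟨rfl, fun h => absurd ((hl l).1 (hc.has.2 h)) (lt_irrefl l), rfl⟩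

/-- In the doubled shape the three rules for a failed adjunction become one: terminate at the bottom
box of the column containing the last box of row `e`. `Blocked.reason` guarantees that this row is
nonempty. -/
theorem Terminates.of_blocked {T : Filling} (hT : T.IsIncreasing) {x e l : ℕ}
    (hc : Continues T x e) (hs : ¬ (tab T x e).Bumps e (letter T x e))
    (hl : ∀ j, (tab T x e).Has e j ↔ j < l) (hb : Blocked T x e l) :
    1 ≤ l ∧ ∃ a, e ≤ a ∧ (∀ i, (tab T x e).Has (l - 1) i ↔ i < a + 1) ∧
      Terminates T x ⟨tab T x e, cell a (l - 1), decide (l - 1 < a)⟩ e a (l - 1) := by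
  have hI := tab_isIncreasing hT x e
  obtain ⟨hl1, hr⟩ := hb.reason hT hc
    (fun j hj => ⟨hc.has.1 ((hl j).2 hj), val_le_of_stop hs ((hl j).2 hj)⟩)
    (fun h => absurd ((hl l).1 (hc.has.2 h)) (lt_irrefl l))
  obtain ⟨n, hn⟩ := hI.exists_length (l - 1)
  have h1 : e < n := (hn e).1 (has_comm.1 ((hl _).2 (by omega)))
  obtain ⟨a, rfl⟩ : ∃ a, n = a + 1 := ⟨n - 1, by omega⟩
  refine ⟨hl1, a, by omega, hn, hc, hs, rfl, rfl, hI, ?_, ?_, ?_, by omega, Or.inr ⟨rfl, ?_⟩⟩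
  · exact has_comm.1 ((hn a).2 (by omega))
  · rw [hl]; omega
  · rw [has_comm, hn]; omega
  · rwa [Nat.sub_add_cancel hl1]

/-- The hypothesis `pos T x k ≤ k` puts the last bump on or below the diagonal. As the path moves
weakly left, all later bumps lie strictly below it, where rounds are column insertions. -/
theorem colInsert_terminates {T : Filling} (hT : T.IsIncreasing) {x e : ℕ}
    (hc : Continues T x e) (hs : ¬ (tab T x e).Bumps e (letter T x e)) (d k : ℕ)
    (hd : k + 1 + d = e) (hk : pos T x k ≤ k) :
    ∃ a b, Terminates T x (colInsert (tab T x (k + 1)) (k + 1) (letter T x (k + 1))) e a b := by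
  induction d generalizing k with
  | zero =>
    obtain rfl : e = k + 1 := by omega
    have hI := tab_isIncreasing hT x (k + 1)
    obtain ⟨l, hl⟩ := hI.exists_length (k + 1)
    have hne : ¬ ((tab T x (k + 1)).colLarger (k + 1) (letter T x (k + 1))).Nonempty := by
      rintro ⟨j, hj⟩
      exact hs ⟨j, ((mem_colLarger_iff hI).1 hj).2⟩
    have hlk : l ≤ k := by
      by_contra hcon
      have h1 : T.Has (k + 1) (pos T x k) := hc.has.1 ((hl _).2 (by omega))
      exact hs ⟨_, hc.has.2 h1, lt_val_below hT hc h1⟩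
    have hend : (tab T x (k + 1)).colEnd (k + 1) = cell (k + 1) l := by
      rw [colEnd, hI.colLen_eq hl, cell_of_ge (by omega), min_eq_left (by omega)]
    rw [colInsert, dif_neg hne, hend]
    split
    case isTrue hb =>
      have h1 := Terminates.of_adjoin hT hc hs hl (not_not.2 hb)
      rw [decide_eq_true (by omega)] at h1
      exact ⟨_, _, h1⟩
    case isFalse hb =>
      obtain ⟨h1, a, h2, hn, h3⟩ := Terminates.of_blocked hT hc hs hl hb
      rw [decide_eq_true (by omega), cell_of_ge (by omega)] at h3
      refine ⟨a, l - 1, ?_⟩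
      convert h3 using 2
      rw [colLast, hI.colLen_eq hl, min_eq_left (by omega), rowLast, hI.rowLen_eq hn]
      congr 1
      omega
  | succ d ih =>
    have hck : Continues T x (k + 2) := hc.mono (by omega)
    have hck' := hck.mono (Nat.le_succ _)
    have hI := tab_isIncreasing hT x (k + 1)
    have hB := hck (k + 1) (by omega)
    have hp : pos T x (k + 1) ≤ k := by
      refine le_trans ?_ hk
      by_contra hcon
      have h1 : T.Has (k + 1) (pos T x k) := hT.has_mono hck.has_pos le_rfl (by omega)
      exact hcon (bumpPos_le (hck'.has.2 h1) (lt_val_below hT hck' h1))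
    have hmem : pos T x (k + 1) ∈
        (tab T x (k + 1)).colLarger (k + 1) (letter T x (k + 1)) :=
      (mem_colLarger_iff hI).2 ⟨by omega, hB.has, hB.lt_val⟩
    have hmin : ((tab T x (k + 1)).colLarger (k + 1) (letter T x (k + 1))).min' ⟨_, hmem⟩
        = pos T x (k + 1) := by
      apply le_antisymm (Finset.min'_le _ _ hmem)
      have h1 := ((mem_colLarger_iff hI).1 (Finset.min'_mem _ ⟨_, hmem⟩)).2
      exact bumpPos_le h1.1 h1.2
    rw [colInsert, dif_pos ⟨_, hmem⟩, hmin, ← cell_of_ge (show pos T x (k + 1) ≤ k + 1 by omega)]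
    exact ih (k + 1) (by omega) (by omega)

/-- The last hypothesis says that the previous bump, if any, lay strictly above the diagonal; the
next one then lies on or above it, and being on it triggers the switch to columns. -/
theorem rowInsert_terminates {T : Filling} (hT : T.IsIncreasing) {x e : ℕ}
    (hc : Continues T x e) (hs : ¬ (tab T x e).Bumps e (letter T x e)) (d k : ℕ)
    (hd : k + d = e) (hk : ∀ m, k = m + 1 → k ≤ pos T x m) :
    ∃ a b, Terminates T x (rowInsert (tab T x k) k (letter T x k)) e a b := by
  induction d generalizing k with
  | zero =>
    obtain rfl : e = k := by omega
    have hI := tab_isIncreasing hT x e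
    obtain ⟨l, hl⟩ := hI.exists_length e
    have hne : ¬ ((tab T x e).rowLarger e (letter T x e)).Nonempty := by
      rintro ⟨j, hj⟩
      exact hs ⟨j, ((mem_rowLarger_iff hI).1 hj).2⟩
    have hlk : e ≤ l := by
      rcases e with _ | m
      · omega
      · have h1 : T.Has m (m + 1) := hT.has_mono hc.has_pos le_rfl (hk m rfl)
        have := (hl m).1 (hc.has.2 (has_comm.1 h1))
        omega
    have hend : (tab T x e).rowEnd e = cell e l := by
      rw [rowEnd, hI.rowLen_eq hl, cell_of_le hlk, Nat.add_sub_cancel' hlk]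
    rw [rowInsert, dif_neg hne, hend]
    split
    case isTrue hb =>
      have h1 := Terminates.of_adjoin hT hc hs hl (not_not.2 hb)
      rw [decide_eq_false (by omega)] at h1
      exact ⟨_, _, h1⟩
    case isFalse hb =>
      obtain ⟨h1, a, h2, hn, h3⟩ := Terminates.of_blocked hT hc hs hl hb
      refine ⟨a, l - 1, ?_⟩
      rw [hI.rowLen_eq hl]
      split
      case isTrue h0 =>
        rw [decide_eq_true (by omega), cell_of_ge (by omega)] at h3
        -- An empty shifted row: the doubled row `e` ends just before the diagonal, so the terminal
        -- box reflects to the end of shifted row `e - 1`.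
        obtain rfl : e = l := by omega
        convert h3 using 2
        rw [rowLast, hI.rowLen_eq hn]
        congr 1
        omega
      case isFalse h0 =>
        have h4 : a ≤ l - 1 := by
          by_contra hcon
          have h5 := hI.has_mono (i' := e) (j' := l) ((hn l).2 (by omega)) (by omega) le_rfl
          exact absurd ((hl l).1 h5) (lt_irrefl l)
        rw [decide_eq_false (by omega), cell_of_le h4] at h3
        convert h3 using 2
        rw [rowLast, hI.rowLen_eq hl, show e + (l - e) - 1 = l - 1 by omega, colLast,
          hI.colLen_eq hn]
        congr 1
        omega
  | succ d ih =>
    have hck : Continues T x (k + 1) := hc.mono (by omega)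
    have hck' := hck.mono (Nat.le_succ _)
    have hI := tab_isIncreasing hT x k
    have hB := hck k (by omega)
    -- Box `(m + 1, m)` reflects `(m, m + 1)`, which is weakly left of the previous bump. So its
    -- label is at most the current letter, and nothing left of the diagonal can be bumped.
    have hp : k ≤ pos T x k := by
      rcases k with _ | m
      · omega
      by_contra hcon
      have h1 : (tab T x (m + 1)).Has m (m + 1) :=
        hck'.has.2 (hT.has_mono hck'.has_pos le_rfl (hk m rfl))
      have h2 := val_above_le hT hck' (hk m rfl)
      rw [val_comm] at h2
      have h3 := hI.val_le_right (has_comm.1 h1) (show pos T x (m + 1) ≤ m by omega)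
      exact absurd (h3.trans h2) (not_le.2 hB.lt_val)
    have hmem : pos T x k ∈ (tab T x k).rowLarger k (letter T x k) :=
      (mem_rowLarger_iff hI).2 ⟨hp, hB.has, hB.lt_val⟩
    have hmin : ((tab T x k).rowLarger k (letter T x k)).min' ⟨_, hmem⟩ = pos T x k := by
      apply le_antisymm (Finset.min'_le _ _ hmem)
      have h1 := ((mem_rowLarger_iff hI).1 (Finset.min'_mem _ ⟨_, hmem⟩)).2
      exact bumpPos_le h1.1 h1.2
    rw [rowInsert, dif_pos ⟨_, hmem⟩, hmin, ← cell_of_le hp]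
    split
    case isTrue h =>
      exact colInsert_terminates hT hc hs d k (by omega) h.le
    case isFalse h =>
      exact ih (k + 1) (by omega) (fun m hm => by obtain rfl : k = m := by omega
                                                  omega)

theorem insertLetter_terminates {T : Filling} (hT : T.IsIncreasing) (x : ℕ) :
    ∃ e a b, Terminates T x (insertLetter T x) e a b := by
  obtain ⟨e, hc, hs⟩ := exists_stop hT x
  exact ⟨e, rowInsert_terminates hT hc hs e 0 (by omega) (fun m hm => by omega)⟩

/-! ### Comparison of two consecutive insertions -/

/-- A label of row `k` larger than the letter of round `k` bounds the label bumped there. -/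
theorem Continues.bump_of_lt {T : Filling} {x k q : ℕ} (hk : Continues T x k)
    (hT : T.IsIncreasing) (hq : T.Has k q) (hlt : letter T x k < T.val k q) :
    Continues T x (k + 1) ∧ letter T x (k + 1) ≤ T.val k q := by
  have h1 : (tab T x k).val k q = T.val k q := by
    rcases hk.entry_earlier (cell k q) with h1 | ⟨-, h1⟩
    · exact h1
    · exact absurd hlt (not_lt.2 h1)
  rw [← h1] at hlt ⊢
  have h2 := hk.has.2 hq
  exact ⟨hk.succ ⟨q, h2, hlt⟩,
    (tab_isIncreasing hT x k).val_le_right h2 (bumpPos_le h2 hlt)⟩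

/-- A box of row `k` whose final label does not exceed the letter of round `k`, for one of the
two possible reasons. -/
def IsBound (T : Filling) (x : ℕ) (r : InsertResult) (k q : ℕ) : Prop :=
  r.tableau.Has k q ∧ (r.tableau.val k q = letter T x k ∨
    ∃ m, k = m + 1 ∧ pos T x m = q + 1 ∧ Blocked T x m (q + 1))

namespace Terminates

variable {T : Filling} {x x' : ℕ} {r r' : InsertResult} {e a b e' a' b' : ℕ}

theorem has_mono (h : Terminates T x r e a b) {i j : ℕ} (hij : T.Has i j) :
    r.tableau.Has i j := by
  rcases h.result with ⟨-, -, h1⟩ | ⟨h1, -⟩ <;> rw [h1]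
  · exact has_put.2 (Or.inr (h.cont.has.2 hij))
  · exact h.cont.has.2 hij

theorem has_cases (h : Terminates T x r e a b) {i j : ℕ} (hij : r.tableau.Has i j) :
    cell i j = cell a b ∨ T.Has i j := by
  rcases h.result with ⟨rfl, -, h1⟩ | ⟨h1, -⟩ <;> rw [h1] at hij
  · exact (has_put.1 hij).imp_right h.cont.has.1
  · exact Or.inr (h.cont.has.1 hij)

theorem val_of_has (h : Terminates T x r e a b) {i j : ℕ} (hij : T.Has i j) :
    r.tableau.val i j = (tab T x e).val i j := by
  rcases h.result with ⟨-, h0, h1⟩ | ⟨h1, -⟩ <;> rw [h1]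
  refine put_entry_of_ne _ _ fun hcon => h0 ?_
  rwa [Has, hcon] at hij

/-- Labels not larger than the letter of some round stay until the end of the insertion. -/
theorem val_eq_of_le (h : Terminates T x r e a b) {i j k : ℕ} (hij : T.Has i j) (hk : k ≤ e)
    (hle : (tab T x k).val i j ≤ letter T x k) : r.tableau.val i j = (tab T x k).val i j := by
  rw [h.val_of_has hij]
  rcases h.cont.entry_later hk (cell i j) with h1 | ⟨-, h1⟩
  · exact h1
  · exact absurd hle (not_le.2 h1)

/-- If the next letter is not smaller, its letters stay not smaller in all rounds, and its
insertion does not take more rounds. -/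
theorem letter_le (h : Terminates T x r e a b) (hT : T.IsIncreasing) (hx : x ≤ x') (k : ℕ)
    (hk : Continues r.tableau x' k) : k ≤ e ∧ letter T x k ≤ letter r.tableau x' k := by
  induction k with
  | zero => exact ⟨Nat.zero_le e, hx⟩
  | succ k ih =>
    obtain ⟨hke, hle⟩ := ih (hk.mono (Nat.le_succ k))
    have hB := hk k (by omega)
    set p := pos r.tableau x' k with hp
    have hz : letter r.tableau x' k < letter r.tableau x' (k + 1) := hk.letter_lt
    have hval : letter r.tableau x' (k + 1) = r.tableau.val k p := by
      rcases (hk.mono (Nat.le_succ k)).entry_earlier (cell k p) with h1 | ⟨h1, -⟩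
      · exact h1
      · exact absurd h1 (not_lt.2 hz.le)
    rw [hval] at hz ⊢
    have hhas := hk.has_pos
    rw [← hp] at hhas
    -- A label of row `k` exceeding the letter of round `k` after the first insertion is either old,
    -- hence at least the bumped label, or was put there in a later round, hence at least the next
    -- letter.
    have hin : ∀ z, (tab T x e).val k p = z → letter T x k < z → T.Has k p →
        k < e ∧ letter T x (k + 1) ≤ z := by
      rintro z rfl hlt hTk
      rcases hke.eq_or_lt with rfl | hke
      · exact absurd hlt (not_lt.2 (val_le_of_stop h.not_bumps (h.cont.has.2 hTk)))
      refine ⟨hke, ?_⟩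
      have hck : Continues T x (k + 1) := h.cont.mono hke
      rcases h.cont.entry_later hke (cell k p) with h1 | ⟨h1, -⟩
      · rcases tab_succ_entry T x k (cell k p) with h2 | ⟨-, h2, -⟩
        · have h3 : (tab T x e).val k p = (tab T x k).val k p := h1.trans h2
          rw [h3] at hlt ⊢
          have h4 := (hck.mono (Nat.le_succ k)).has.2 hTk
          exact (tab_isIncreasing hT x k).val_le_right h4 (bumpPos_le h4 hlt)
        · exact absurd (h1.trans h2) hlt.ne'
      · exact h1
    by_cases hTk : T.Has k p
    · exact hin _ (h.val_of_has hTk).symm (hle.trans_lt hz) hTk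
    · have h1 := (h.has_cases hhas).resolve_right hTk
      rcases h.result with ⟨rfl, h2, h3⟩ | ⟨h3, -⟩
      · have h4 : r.tableau.val k p = letter T x a := by
          rw [val, h1, h3, put_entry_self]
        rw [h4] at hz ⊢
        rcases hke.eq_or_lt with rfl | hke
        · exact absurd (hle.trans_lt hz) (lt_irrefl _)
        · exact ⟨hke, h.cont.letter_mono hke⟩
      · rw [h3] at hhas
        exact absurd (h.cont.has.1 hhas) hTk

theorem le_of_has (h : Terminates T x r e a b) {i : ℕ} (hi : r.tableau.Has i b) : i ≤ a := by
  by_contra hcon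
  exact h.not_has_below (h.inc.has_mono hi (by omega) le_rfl)

/-- The boxes where two consecutive insertions terminate cannot be strictly ordered in both
coordinates. -/
theorem not_lt_lt (h : Terminates T x r e a b) (h' : Terminates r.tableau x' r' e' a' b') :
    ¬ (a < a' ∧ b < b') := by
  rintro ⟨ha, hb⟩
  have h1 := h'.inc.has_mono (i' := a + 1) (j' := b) h'.has (by omega) (by omega)
  rcases h'.has_cases h1 with h2 | h2
  · simp only [cell, Prod.mk.injEq] at h2
    omega
  · exact h.not_has_below h2

/-- Since `e' ≤ e ≤ a`, row `e'` of the final shape reaches column `b`, so `b ≤ b'`. Equality forces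
the same box; otherwise `not_lt_lt` applies. -/
theorem nondescent (hT : T.IsIncreasing) (h : Terminates T x r e a b)
    (h' : Terminates r.tableau x' r' e' a' b') (hx : x ≤ x') :
    a' ≤ a ∧ (b < b' ∨ a' = a ∧ b' = b) := by
  have he := (h.letter_le hT hx e' h'.cont).1
  have hab : r'.tableau.Has a b := h'.has_mono h.has
  have hbb : b ≤ b' := by
    by_contra hcon
    exact h'.not_has_right (h'.inc.has_mono hab (he.trans h.le) (by omega))
  rcases hbb.eq_or_lt with rfl | hbb
  · have h1 := h'.le_of_has hab
    rcases h'.result with ⟨h2, h3, -⟩ | ⟨h2, -⟩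
    · obtain rfl : a = a' := le_antisymm h1 (by have := h.le; omega)
      exact ⟨le_rfl, Or.inr ⟨rfl, rfl⟩⟩
    · have h3 := h'.has
      rw [h2] at h3
      have h4 := h.le_of_has (h'.cont.has.1 h3)
      obtain rfl : a = a' := le_antisymm h1 h4
      exact ⟨le_rfl, Or.inr ⟨rfl, rfl⟩⟩
  · refine ⟨?_, Or.inl hbb⟩
    by_contra hcon
    exact h.not_lt_lt h' ⟨by omega, hbb⟩

/-- The bound is the replaced box if the replacement succeeded, and its left neighbour if it was
blocked. -/
theorem exists_isBound (h : Terminates T x r e a b) (hT : T.IsIncreasing) {k : ℕ} (hk : k < e) :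
    ∃ q, IsBound T x r k q ∧ r.tableau.val k q ≤ letter T x k ∧
      (Blocked T x k (pos T x k) → q + 1 = pos T x k) := by
  have hc : Continues T x (k + 1) := h.cont.mono hk
  by_cases hb : Blocked T x k (pos T x k)
  · obtain ⟨h1, h2⟩ := hb.reason hT (hc.mono (Nat.le_succ k))
      (fun j hj => ⟨hT.has_mono hc.has_pos le_rfl hj.le, val_le_of_lt_pos hT hc hj⟩)
      (fun _ => hc.letter_lt)
    have h3 : T.Has k (pos T x k - 1) := hT.has_mono hc.has_pos le_rfl (by omega)
    have h4 := val_le_of_lt_pos hT hc (show pos T x k - 1 < pos T x k by omega)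
    have h5 := h.val_eq_of_le h3 hk.le h4
    refine ⟨pos T x k - 1, ⟨h.has_mono h3, ?_⟩, h5.trans_le h4, fun _ => by omega⟩
    rwa [h5, Nat.sub_add_cancel h1]
  · have h1 := val_pos_of_not_blocked hb
    have h2 := h.val_eq_of_le hc.has_pos hk (h1.trans_le hc.letter_lt.le)
    exact ⟨pos T x k, ⟨h.has_mono hc.has_pos, Or.inl (h2.trans h1)⟩, (h2.trans h1).le,
      fun hcon => absurd hcon hb⟩

theorem isBound_last (h : Terminates T x r e a b) : IsBound T x r e b := by
  refine ⟨h.inc.has_mono h.has h.le le_rfl, ?_⟩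
  rcases h.result with ⟨-, -, h1⟩ | ⟨h1, h2⟩ <;> rw [h1]
  · exact Or.inl (put_entry_self _ _ _)
  · exact h2

/-- If the next letter is smaller, its letters stay smaller than the bounds left behind by the
first insertion. -/
theorem letter_lt_bound (h : Terminates T x r e a b) (hT : T.IsIncreasing) (hx : x' < x) (k : ℕ)
    (hk : k ≤ e) : Continues r.tableau x' k ∧
      ∀ q, IsBound T x r k q → letter r.tableau x' k < r.tableau.val k q := by
  induction k with
  | zero =>
    refine ⟨fun i hi => absurd hi (Nat.not_lt_zero i), ?_⟩
    rintro q ⟨-, h1 | ⟨m, h1, -⟩⟩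
    · rw [h1]; exact hx
    · omega
  | succ k ih =>
    obtain ⟨hc', ih⟩ := ih (by omega)
    obtain ⟨q₀, hq₀, hle, hbl⟩ := h.exists_isBound hT hk
    obtain ⟨h1, h2⟩ := hc'.bump_of_lt h.inc hq₀.1 (ih q₀ hq₀)
    refine ⟨h1, ?_⟩
    rintro q ⟨hq, h3 | ⟨m, h3, h4, h5⟩⟩
    · rw [h3]
      exact (h2.trans hle).trans_lt (h.cont.mono hk).letter_lt
    · obtain rfl : k = m := by omega
      have h6 := hbl (by rwa [h4])
      obtain rfl : q₀ = q := by omega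
      -- After a blocked round the two bounds are vertically adjacent, so column strictness replaces
      -- the comparison with the letter.
      exact h2.trans_lt (h.inc.val_lt_down hq (by omega))

/-- From row `e` to row `a` the second insertion bumps because of column `b`: its letter is at most
the label one row up, hence smaller than the present one. -/
theorem continues_of_lt (h : Terminates T x r e a b) (hT : T.IsIncreasing) (hx : x' < x) (d : ℕ)
    (hd : e + d ≤ a) : Continues r.tableau x' (e + d + 1) ∧
      letter r.tableau x' (e + d + 1) ≤ r.tableau.val (e + d) b := by
  induction d with
  | zero =>
    obtain ⟨h1, h2⟩ := h.letter_lt_bound hT hx e le_rfl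
    exact h1.bump_of_lt h.inc h.isBound_last.1 (h2 b h.isBound_last)
  | succ d ih =>
    obtain ⟨h1, h2⟩ := ih (by omega)
    have h3 := h.inc.has_mono h.has hd le_rfl
    exact h1.bump_of_lt h.inc h3 (h2.trans_lt (h.inc.val_lt_down h3 (by omega)))

theorem descent (hT : T.IsIncreasing) (h : Terminates T x r e a b)
    (h' : Terminates r.tableau x' r' e' a' b') (hx : x' < x) : a < a' ∧ b' ≤ b := by
  have h1 := (h.continues_of_lt hT hx (a - e) (by have := h.le; omega)).1
  rw [Nat.add_sub_cancel' h.le] at h1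
  have h2 : a < e' := by
    by_contra hcon
    exact h'.not_bumps (h1 e' (by omega))
  have h3 := h'.le
  refine ⟨by omega, ?_⟩
  by_contra hcon
  exact h.not_lt_lt h' ⟨by omega, by omega⟩

end Terminates

/-! ### Descents of words and of recording tableaux -/

/-- The insertions of two consecutive letters: their letters form a descent if and only if their
recording labels do. -/
theorem descent_iff {T : Filling} (hT : T.IsIncreasing) (x x' : ℕ) :
    let r := insertLetter T x
    let r' := insertLetter r.tableau x'
    x' < x ↔ (r.primed = false ∧ r'.primed = true) ∨
      (r.primed = false ∧ r'.primed = false ∧ r.box.1 < r'.box.1) ∨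
      (r.primed = true ∧ r'.primed = true ∧ r'.box.1 ≤ r.box.1 ∧ r.box ≠ r'.box) := by
  intro r r'
  obtain ⟨e, a, b, h⟩ := insertLetter_terminates hT x
  obtain ⟨e', a', b', h'⟩ := insertLetter_terminates h.inc x'
  have h1 : r.box = cell a b := h.box_eq
  have h2 : r'.box = cell a' b' := h'.box_eq
  have h3 : r.primed = decide (b < a) := h.primed_eq
  have h4 : r'.primed = decide (b' < a') := h'.primed_eq
  rw [h1, h2, h3, h4]
  -- The shifted row is `a` for an unprimed label and `b` for a primed one, so what remains is
  -- arithmetic on `a`, `b`, `a'`, `b'`.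
  simp only [cell, ne_eq, Prod.mk.injEq, decide_eq_true_eq, decide_eq_false_iff_not]
  rcases lt_or_ge x' x with hx | hx
  · have := Terminates.descent hT h h' hx
    refine iff_of_true hx ?_
    omega
  · have := Terminates.nondescent hT h h' hx
    refine iff_of_false (not_lt.2 hx) ?_
    omega

theorem run_append_singleton (w : List ℕ) (x : ℕ) : run (w ++ [x]) = (run w).step x := by
  rw [run, List.foldl_append]
  rfl

theorem run_len (w : List ℕ) : (run w).len = w.length := by
  induction w using List.reverseRecOn with
  | nil => rfl
  | append_singleton w x ih => rw [run_append_singleton, List.length_append, State.step, ih]; rfl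

theorem insertionTableau_isIncreasing (w : List ℕ) : (insertionTableau w).IsIncreasing := by
  induction w using List.reverseRecOn with
  | nil => exact empty_isIncreasing
  | append_singleton w x ih =>
    rw [insertionTableau, run_append_singleton]
    obtain ⟨e, a, b, h⟩ := insertLetter_terminates ih x
    exact h.inc

/-- The labels of the recording tableau. -/
theorem mem_recordingTableau_iff (w : List ℕ) (l : Label) (s : ℕ × ℕ) :
    l ∈ recordingTableau w s ↔ ∃ u x v, w = u ++ x :: v ∧ l.value = u.length + 1 ∧
      (insertLetter (insertionTableau u) x).box = s ∧
      (insertLetter (insertionTableau u) x).primed = l.primed := by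
  induction w using List.reverseRecOn with
  | nil => simp [recordingTableau, run]
  | append_singleton w y ih =>
    have hstep : l ∈ recordingTableau (w ++ [y]) s ↔ l ∈ recordingTableau w s ∨
        (insertLetter (insertionTableau w) y).box = s ∧
          l = ⟨w.length + 1, (insertLetter (insertionTableau w) y).primed⟩ := by
      rw [recordingTableau, run_append_singleton, State.step, run_len]
      change l ∈ Function.update (recordingTableau w) _ _ s ↔ _
      by_cases hs : s = (insertLetter (insertionTableau w) y).box
      · subst hs
        erw [Function.update_self, Finset.mem_insert]
        simp only [true_and]
        exact or_comm
      · erw [Function.update_of_ne hs]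
        simp [Ne.symm hs]
    rw [hstep, ih]
    constructor
    · rintro (⟨u, x, v, rfl, h⟩ | ⟨h1, rfl⟩)
      · exact ⟨u, x, v ++ [y], by simp, h⟩
      · exact ⟨w, y, [], rfl, rfl, h1, rfl⟩
    · rintro ⟨u, x, v, h1, h2, h3, h4⟩
      rcases List.eq_nil_or_concat v with rfl | ⟨v, z, rfl⟩
      · obtain ⟨rfl, h⟩ := List.append_inj' h1 rfl
        obtain rfl : y = x := by simpa using h
        right
        refine ⟨h3, ?_⟩
        cases l
        simp_all
      · left
        rw [List.concat_eq_append, ← List.cons_append, ← List.append_assoc] at h1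
        exact ⟨u, x, v, (List.append_inj' h1 rfl).1, h2, h3, h4⟩

end ShiftedHecke

open ShiftedHecke in
theorem mainTheorem7 (w : List ℕ) (hw : ∀ a ∈ w, 0 < a) :
    ShiftedHecke.wordDescents w =
      ShiftedHecke.tableauDescents (ShiftedHecke.recordingTableau w) := by
  ext i
  have hlab : ∀ i p s, (⟨i, p⟩ : Label) ∈ recordingTableau w s ↔ ∃ u x v, w = u ++ x :: v ∧
      i = u.length + 1 ∧ (insertLetter (insertionTableau u) x).box = s ∧
      (insertLetter (insertionTableau u) x).primed = p :=
    fun i p s => mem_recordingTableau_iff w ⟨i, p⟩ s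
  have hlen : ∀ p s, (⟨i, p⟩ : Label) ∈ recordingTableau w s → 1 ≤ i := by
    intro p s h
    obtain ⟨u, x, v, -, h, -⟩ := (hlab _ _ _).1 h
    omega
  have hlen' : ∀ p s, (⟨i + 1, p⟩ : Label) ∈ recordingTableau w s → i < w.length := by
    intro p s h
    obtain ⟨u, x, v, rfl, h, -⟩ := (hlab _ _ _).1 h
    simp
    omega
  by_cases hi : 1 ≤ i ∧ i < w.length
  · obtain ⟨hi1, hi2⟩ := hi
    obtain ⟨u, x, x', v, rfl, rfl⟩ : ∃ u x x' v, w = u ++ x :: x' :: v ∧ i = u.length + 1 := by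
      refine ⟨w.take (i - 1), w[i - 1], w[i], w.drop (i + 1), ?_, ?_⟩
      · have h1 := List.drop_eq_getElem_cons (l := w) (i := i) hi2
        have h2 := List.drop_eq_getElem_cons (l := w) (i := i - 1) (by omega)
        rw [Nat.sub_add_cancel hi1] at h2
        rw [← h1, ← h2, List.take_append_drop]
      · rw [List.length_take]; omega
    set r := insertLetter (insertionTableau u) x with hr
    set r' := insertLetter r.tableau x' with hr'
    have hru : insertionTableau (u ++ [x]) = r.tableau := by
      rw [insertionTableau, run_append_singleton]; rfl
    have h1 : ∀ p s, (⟨u.length + 1, p⟩ : Label) ∈ recordingTableau (u ++ x :: x' :: v) s ↔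
        r.box = s ∧ r.primed = p := by
      intro p s
      rw [hlab]
      constructor
      · rintro ⟨u', y, v', h1, h2, h3⟩
        obtain ⟨rfl, h4⟩ := List.append_inj h1 (by omega)
        obtain ⟨rfl, -⟩ := List.cons.inj h4
        exact h3
      · exact fun h => ⟨u, x, x' :: v, rfl, rfl, h⟩
    have h2 : ∀ p s, (⟨u.length + 1 + 1, p⟩ : Label) ∈ recordingTableau (u ++ x :: x' :: v) s ↔
        r'.box = s ∧ r'.primed = p := by
      intro p s
      rw [hlab]
      have h0 : u ++ x :: x' :: v = (u ++ [x]) ++ x' :: v := by simp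
      constructor
      · rintro ⟨u', y, v', h1, h2, h3⟩
        rw [h0] at h1
        obtain ⟨rfl, h4⟩ := List.append_inj h1 (by simp; omega)
        obtain ⟨rfl, -⟩ := List.cons.inj h4
        rwa [hru] at h3
      · exact fun h => ⟨u ++ [x], x', v, h0, by simp, by rwa [hru]⟩
    have hL : u.length + 1 ∈ wordDescents (u ++ x :: x' :: v) ↔ x' < x := by
      simp [wordDescents]
    have hR : u.length + 1 ∈ tableauDescents (recordingTableau (u ++ x :: x' :: v)) ↔
        (r.primed = false ∧ r'.primed = true) ∨
        (r.primed = false ∧ r'.primed = false ∧ r.box.1 < r'.box.1) ∨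
        (r.primed = true ∧ r'.primed = true ∧ r'.box.1 ≤ r.box.1 ∧ r.box ≠ r'.box) := by
      simp only [tableauDescents, Set.mem_ofPred_eq, h1, h2]
      aesop
    rw [hL, hR]
    exact descent_iff (insertionTableau_isIncreasing u) x x'
  · refine iff_of_false ?_ ?_
    · rintro ⟨h1, a, b, -, h2, -⟩
      obtain ⟨h2, -⟩ := List.getElem?_eq_some_iff.1 h2
      exact hi ⟨h1, h2⟩
    · rintro (⟨s, t, h1, h2⟩ | ⟨s, t, h1, h2, -⟩ | ⟨s, t, h1, h2, -⟩) <;>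
        exact hi ⟨hlen _ _ h1, hlen' _ _ h2⟩
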